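/- Let $K$ be $\mathbb{R}$, $\mathbb{C}$ or the quaternions $\mathbb{H}$, let $0\le d<N$ be integers, and let $p\ge 2$ be a real number. Let $A\in K^{N\times N}$ be a matrix of rank $d$ with $A_{ii}=1$ for all $i$; here the rank is the dimension of the span of the columns of $A$ in the right $K$-vector space $K^N$. (The matrix $A$ is not assumed to be Hermitian.) Put $$\beta=\sqrt{\frac{1}{N-d+2(\dim_{\mathbb{R}}K)^{-1}}},\qquad M=N-d+\frac{(N-d)^2-(N-d)}{2}\,\dim_{\mathbb{R}}K .$$ Then $$\Bigl(\sum_{i\neq j}|A_{ij}|^p\Bigr)^{1/p}\ \ge\ \frac{N}{\Bigl(N^2\bigl(\beta^{p/(p-1)}+\tfrac1M(1-\beta^{p/(p-1)})\bigr)-N\Bigr)^{1-1/p}} .$$ -/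

import Mathlib

open scoped Quaternion

noncomputable section

/-- The rank of a matrix over a (possibly noncommutative) division ring `K`: the dimension of its
column space, where the space of column vectors `m → K` is a right `K`-vector space (a module over
`Kᵐᵒᵖ`). This is the rank of `A` as the right `K`-linear map `v ↦ A v`. -/
def colRank {K : Type*} [DivisionRing K] {m n : Type*} (A : Matrix m n K) : ℕ :=
  Module.finrank Kᵐᵒᵖ (Submodule.span Kᵐᵒᵖ (Set.range A.col))

/-- Over a (commutative) field, `colRank` is the usual rank. -/
theorem colRank_eq_rank {K : Type*} [Field K] {m n : Type*} [Fintype n] (A : Matrix m n K) :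
    colRank A = A.rank := by
  rw [Matrix.rank_eq_finrank_span_cols]
  have h : ∀ x : m → K, x ∈ Submodule.span Kᵐᵒᵖ (Set.range A.col) ↔
      x ∈ Submodule.span K (Set.range A.col) := by
    intro x
    constructor
    · intro hx
      induction hx using Submodule.span_induction with
      | mem x hx => exact Submodule.subset_span hx
      | zero => exact Submodule.zero_mem _
      | add x y _ _ hx hy => exact Submodule.add_mem _ hx hy
      | smul a x _ hx =>
        have := Submodule.smul_mem _ a.unop hx
        rwa [← op_smul_eq_smul, MulOpposite.op_unop] at this
    · intro hx
      induction hx using Submodule.span_induction with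
      | mem x hx => exact Submodule.subset_span hx
      | zero => exact Submodule.zero_mem _
      | add x y _ _ hx hy => exact Submodule.add_mem _ hx hy
      | smul a x _ hx =>
        rw [← op_smul_eq_smul]
        exact Submodule.smul_mem _ _ hx
  let e : Submodule.span Kᵐᵒᵖ (Set.range A.col) ≃+ Submodule.span K (Set.range A.col) :=
    { toFun := fun x => ⟨x.1, (h x.1).1 x.2⟩
      invFun := fun x => ⟨x.1, (h x.1).2 x.2⟩
      left_inv := fun _ => rfl
      right_inv := fun _ => rfl
      map_add' := fun _ _ => rfl }
  have hr := rank_eq_of_equiv_equiv (R := Kᵐᵒᵖ) (R' := K) (MulOpposite.unop) e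
    MulOpposite.unop_bijective (fun r x => Subtype.ext (by
      funext i
      change x.1 i * r.unop = r.unop * x.1 i
      exact mul_comm _ _))
  unfold colRank Module.finrank
  rw [hr]

/-- The off-diagonal `p`-norm `(∑_{i ≠ j} |A i j| ^ p) ^ (1 / p)` of a square matrix. -/
def offDiagNorm {K : Type*} [Norm K] {N : ℕ} (p : ℝ) (A : Matrix (Fin N) (Fin N) K) : ℝ :=
  (∑ ij ∈ (Finset.univ : Finset (Fin N)).offDiag, ‖A ij.1 ij.2‖ ^ p) ^ (1 / p)

/-- `β = √(1 / (n + 2 (dim_ℝ K)⁻¹))`, the cosine of a maximal simplex in dimension `n`. -/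
def simplexCos (K : Type*) [AddCommGroup K] [Module ℝ K] (n : ℕ) : ℝ :=
  Real.sqrt (1 / ((n : ℝ) + 2 * (Module.finrank ℝ K : ℝ)⁻¹))

/-- `M = n + (n ^ 2 - n) / 2 * dim_ℝ K`, the size of a maximal simplex in dimension `n`. -/
def simplexSize (K : Type*) [AddCommGroup K] [Module ℝ K] (n : ℕ) : ℝ :=
  (n : ℝ) + ((n : ℝ) ^ 2 - n) / 2 * (Module.finrank ℝ K : ℝ)

/-- The lower bound
`N / (N² (β^(p/(p-1)) + (1/M) (1 - β^(p/(p-1)))) - N)^(1 - 1/p)`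
with `β` and `M` computed in dimension `n`. -/
def energyLowerBound (K : Type*) [AddCommGroup K] [Module ℝ K] (N n : ℕ) (p : ℝ) : ℝ :=
  (N : ℝ) /
    ((N : ℝ) ^ 2 *
        (simplexCos K n ^ (p / (p - 1)) +
          1 / simplexSize K n * (1 - simplexCos K n ^ (p / (p - 1)))) - N) ^ (1 - 1 / p)

end

/-! Let `q` be conjugate to `p`, `k = N - d`, and let `U` be the right kernel of `A`, of dimension
`k`. For vectors `f a` in `U`, the kernel `G i j = ∑ a, f a i * star (f a j)` satisfies `A G = 0`.
As `A` has unit diagonal, each `G i i` is minus the off-diagonal part of its row, and Hölder bounds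
`∑ i, G i i` by the `p`-norm of `A` off the diagonal times the `q`-norm of `G` off the diagonal. It
remains to choose a basis for which the latter is small.

The choice is Lewis' position (`exists_lewis_weights`): weights `c` and a `c`-orthonormal basis of
`U` with `c i * l i = l i ^ (q / 2)`, where `l i = G i i`. The rank one Hermitian matrices `P i`
built from the coordinates satisfy `∑ c i • P i = 1`, have trace `l i` and inner products `‖G i j‖ ^
2`. So the `P i / l i` with masses `c i * l i / k` form an isotropic probability measure, and the
`q`-energy of `G` is `k ^ 2` times its energy for the potential `s ^ (q / 2)`.

That energy is bounded by linear programming (`sum_inner_rpow_le_simplex`): the potential lies below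
a concave quadratic (`exists_quadratic_majorant_rpow`), the mean inner product is `1 / k`, and
Welch's inequality bounds the second moment from below. Equality corresponds to a simplex of `M`
vertices with inner products `b = β ^ 2`.

Jensen's inequality, applied to the `l i`, removes the dependence on the basis. -/

/-! ### A quadratic majorant of the power function -/

/-- Sign pattern of a concave function with two zeros. -/
theorem ConcaveOn.nonpos_left_of_zeros {S : Set ℝ} {f : ℝ → ℝ} (hf : ConcaveOn ℝ S f)
    {x a b : ℝ} (hx : x ∈ S) (hb : b ∈ S) (hxa : x < a) (hab : a < b)
    (ha0 : f a = 0) (hb0 : f b = 0) : f x ≤ 0 := by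
  have h := hf.slope_anti_adjacent hx hb hxa hab
  rw [ha0, hb0, sub_zero, zero_div, zero_sub, le_div_iff₀ (sub_pos.2 hxa)] at h
  linarith

theorem ConcaveOn.nonpos_right_of_zeros {S : Set ℝ} {f : ℝ → ℝ} (hf : ConcaveOn ℝ S f)
    {x a b : ℝ} (hx : x ∈ S) (ha : a ∈ S) (hbx : b < x) (hab : a < b)
    (ha0 : f a = 0) (hb0 : f b = 0) : f x ≤ 0 := by
  have h := hf.slope_anti_adjacent ha hx hab hbx
  rw [ha0, hb0, sub_zero, sub_zero, zero_div, div_le_iff₀ (sub_pos.2 hbx)] at h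
  linarith

theorem ConcaveOn.nonneg_between_zeros {S : Set ℝ} {f : ℝ → ℝ} (hf : ConcaveOn ℝ S f)
    {x a b : ℝ} (ha : a ∈ S) (hb : b ∈ S) (hax : a < x) (hxb : x < b)
    (ha0 : f a = 0) (hb0 : f b = 0) : 0 ≤ f x := by
  have h := hf.slope_anti_adjacent ha hb hax hxb
  rw [ha0, hb0, sub_zero, zero_sub,
    div_le_div_iff₀ (sub_pos.2 hxb) (sub_pos.2 hax)] at h
  nlinarith

theorem convexOn_rpow_of_nonpos {a : ℝ} (ha : a ≤ 0) :
    ConvexOn ℝ (Set.Ioi 0) fun x : ℝ => x ^ a := by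
  have h1 : ConvexOn ℝ (Set.Ioi 0) fun x : ℝ => -a * (-Real.log x) :=
    (strictConcaveOn_log_Ioi.concaveOn.neg).smul (neg_nonneg.2 ha)
  have h2 : ConvexOn ℝ (Set.Ioi 0) fun x : ℝ => Real.exp (-a * (-Real.log x)) := by
    refine ⟨h1.1, fun x hx y hy s t hs ht hst => ?_⟩
    refine (Real.exp_le_exp.2 (h1.2 hx hy hs ht hst)).trans ?_
    exact convexOn_exp.2 (Set.mem_univ _) (Set.mem_univ _) hs ht hst
  refine h2.congr fun x hx => ?_
  simp only [Real.rpow_def_of_pos (Set.mem_Ioi.1 hx)]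
  ring_nf

/-- For `0 < r ≤ 1`, the power `s ^ r` lies on `[0, 1]` below the concave quadratic polynomial that
is tangent to it at `b` and meets it at `1`. -/
theorem exists_quadratic_majorant_rpow {r b : ℝ} (hr0 : 0 < r) (hr1 : r ≤ 1) (hb0 : 0 < b)
    (hb1 : b < 1) :
    ∃ l c : ℝ, 0 ≤ c ∧ b ^ r + l * (1 - b) - c * (1 - b) ^ 2 = 1 ∧
      ∀ s ∈ Set.Icc (0 : ℝ) 1, s ^ r ≤ b ^ r + l * (s - b) - c * (s - b) ^ 2 := by
  have h1b : 0 < 1 - b := sub_pos.2 hb1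
  set l : ℝ := r * b ^ (r - 1) with hl
  set c : ℝ := (b ^ r + l * (1 - b) - 1) / (1 - b) ^ 2 with hc
  have hc0 : 0 ≤ c := by
    apply div_nonneg _ (by positivity)
    -- Bernoulli at `1 / b`, scaled by `b ^ r`, says that the tangent at `b` is at least `1` at the
    -- point `1`; hence the correction `c` has the right sign.
    have h := rpow_one_add_le_one_add_mul_self (s := 1 / b - 1)
      (by have : 0 < 1 / b := by positivity
          linarith) hr0.le hr1
    have e1 : (1 + (1 / b - 1)) ^ r = 1 / b ^ r := by
      rw [add_sub_cancel, Real.div_rpow zero_le_one hb0.le, Real.one_rpow]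
    have hbr : 0 < b ^ r := by positivity
    rw [e1, div_le_iff₀ hbr] at h
    have e2 : l = r * (b ^ r / b) := by rw [hl, Real.rpow_sub_one hb0.ne']
    rw [e2]
    have e3 : (1 + r * (1 / b - 1)) * b ^ r = b ^ r + r * (b ^ r / b) * (1 - b) := by
      field_simp
    linarith
  have heq : b ^ r + l * (1 - b) - c * (1 - b) ^ 2 = 1 := by
    rw [hc]; field_simp; ring
  refine ⟨l, c, hc0, heq, ?_⟩
  set φ : ℝ → ℝ := fun s => b ^ r + l * (s - b) - c * (s - b) ^ 2 - s ^ r with hφ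
  set ψ : ℝ → ℝ := fun s => l - 2 * c * (s - b) - r * s ^ (r - 1) with hψ
  have hder : ∀ s, 0 < s → HasDerivAt φ (ψ s) s := by
    intro s hs
    have h1 := ((hasDerivAt_id s).sub_const b)
    have h2 := ((h1.const_mul l).const_add (b ^ r)).sub ((h1.pow 2).const_mul c)
    have h3 := h2.sub (Real.hasDerivAt_rpow_const (p := r) (Or.inl hs.ne'))
    refine h3.congr_deriv ?_
    simp [hψ]; ring
  have hcont : Continuous φ := by
    have : Continuous fun s : ℝ => s ^ r := Real.continuous_rpow_const hr0.le
    simp only [hφ]; fun_prop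
  have hφb : φ b = 0 := by simp [hφ]
  have hφ1 : φ 1 = 0 := by simp [hφ, heq]
  have hψb : ψ b = 0 := by simp [hψ, hl]
  have hψc : ConcaveOn ℝ (Set.Ioi 0) ψ := by
    have h1 : ConvexOn ℝ (Set.Ioi 0) fun s : ℝ => r * s ^ (r - 1) :=
      (convexOn_rpow_of_nonpos (by linarith)).smul hr0.le
    refine ⟨convex_Ioi 0, fun x hx y hy s t hs ht hst => ?_⟩
    have h2 := h1.2 hx hy hs ht hst
    simp only [smul_eq_mul] at h2
    simp only [hψ, smul_eq_mul]
    have e : t = 1 - s := by linarith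
    subst e
    linarith
  -- Rolle gives the concave derivative `ψ` a second zero besides `b`. Its signs are then `-, +, -`
  -- on the three intervals, so `φ` is smallest at `b` or at `1`, where it vanishes.
  obtain ⟨ξ, hξ, hξ0⟩ : ∃ ξ ∈ Set.Ioo b 1, ψ ξ = 0 :=
    exists_hasDerivAt_eq_zero hb1 hcont.continuousOn (hφb.trans hφ1.symm)
      fun x hx => hder x (hb0.trans hx.1)
  have hξp : (0 : ℝ) < ξ := hb0.trans hξ.1
  have key : ∀ s ∈ Set.Icc (0 : ℝ) 1, 0 ≤ φ s := by
    rintro s ⟨hs0, hs1⟩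
    rcases le_total s b with hsb | hsb
    · have hanti : AntitoneOn φ (Set.Icc 0 b) := by
        refine antitoneOn_of_deriv_nonpos (convex_Icc 0 b) hcont.continuousOn
          (fun x hx => ?_) (fun x hx => ?_) <;> rw [interior_Icc] at hx
        · exact (hder x hx.1).differentiableAt.differentiableWithinAt
        · rw [(hder x hx.1).deriv]
          exact hψc.nonpos_left_of_zeros (Set.mem_Ioi.2 hx.1) (Set.mem_Ioi.2 hξp) hx.2 hξ.1 hψb hξ0
      have := hanti ⟨hs0, hsb⟩ ⟨hb0.le, le_rfl⟩ hsb
      rwa [hφb] at this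
    rcases le_total s ξ with hsx | hsx
    · have hmono : MonotoneOn φ (Set.Icc b ξ) := by
        refine monotoneOn_of_deriv_nonneg (convex_Icc b ξ) hcont.continuousOn
          (fun x hx => ?_) (fun x hx => ?_) <;> rw [interior_Icc] at hx
        · exact (hder x (hb0.trans hx.1)).differentiableAt.differentiableWithinAt
        · rw [(hder x (hb0.trans hx.1)).deriv]
          exact hψc.nonneg_between_zeros (Set.mem_Ioi.2 hb0) (Set.mem_Ioi.2 hξp) hx.1 hx.2 hψb hξ0
      have := hmono ⟨le_rfl, hξ.1.le⟩ ⟨hsb, hsx⟩ hsb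
      rwa [hφb] at this
    · have hanti : AntitoneOn φ (Set.Icc ξ 1) := by
        refine antitoneOn_of_deriv_nonpos (convex_Icc ξ 1) hcont.continuousOn
          (fun x hx => ?_) (fun x hx => ?_) <;> rw [interior_Icc] at hx
        · exact (hder x (hξp.trans hx.1)).differentiableAt.differentiableWithinAt
        · rw [(hder x (hξp.trans hx.1)).deriv]
          exact hψc.nonpos_right_of_zeros (Set.mem_Ioi.2 (hξp.trans hx.1)) (Set.mem_Ioi.2 hb0)
            hx.1 hξ.1 hψb hξ0
      have := hanti ⟨hsx, hs1⟩ ⟨hξ.2.le, le_rfl⟩ hs1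
      rwa [hφ1] at this
  intro s hs
  have := key s hs
  simp only [hφ] at this
  linarith

/-! ### Weighted Welch inequality -/

section Welch

variable {ι V : Type*} [Fintype ι] [NormedAddCommGroup V] [InnerProductSpace ℝ V]
  [FiniteDimensional ℝ V]

/-- A weighted Welch inequality. -/
theorem sq_sum_mul_norm_sq_le (m : ι → ℝ) (y : ι → V) :
    (∑ i, m i * ‖y i‖ ^ 2) ^ 2 ≤
      Module.finrank ℝ V * ∑ i, ∑ j, m i * m j * inner ℝ (y i) (y j) ^ 2 := by
  set e := stdOrthonormalBasis ℝ V
  -- `T` is the matrix of `∑ m i • y i ⊗ y i`; the claim compares its squared trace with its squared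
  -- Hilbert–Schmidt norm.
  set T : Fin (Module.finrank ℝ V) → Fin (Module.finrank ℝ V) → ℝ :=
    fun a b => ∑ i, m i * inner ℝ (y i) (e a) * inner ℝ (e b) (y i) with hT
  have h1 : ∑ i, m i * ‖y i‖ ^ 2 = ∑ a, T a a := by
    simp only [hT]
    rw [Finset.sum_comm]
    refine Finset.sum_congr rfl fun i _ => ?_
    rw [← real_inner_self_eq_norm_sq, ← e.sum_inner_mul_inner (y i) (y i), Finset.mul_sum]
    simp only [mul_assoc]
  have h2 : ∑ i, ∑ j, m i * m j * inner ℝ (y i) (y j) ^ 2 = ∑ a, ∑ b, T a b ^ 2 := by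
    calc _ = ∑ i, ∑ j, ∑ a, ∑ b, (m i * inner ℝ (y i) (e a) * inner ℝ (e b) (y i)) *
          (m j * inner ℝ (y j) (e a) * inner ℝ (e b) (y j)) := by
          refine Finset.sum_congr rfl fun i _ => Finset.sum_congr rfl fun j _ => ?_
          rw [← e.sum_inner_mul_inner (y i) (y j), sq, Finset.sum_mul_sum, Finset.mul_sum]
          refine Finset.sum_congr rfl fun a _ => ?_
          rw [Finset.mul_sum]
          refine Finset.sum_congr rfl fun b _ => ?_
          rw [real_inner_comm (e a) (y j), real_inner_comm (y i) (e b)]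
          ring
      _ = ∑ a, ∑ b, ∑ i, ∑ j, (m i * inner ℝ (y i) (e a) * inner ℝ (e b) (y i)) *
          (m j * inner ℝ (y j) (e a) * inner ℝ (e b) (y j)) := by
          simp_rw [Finset.sum_comm (s := (Finset.univ : Finset ι))
            (t := (Finset.univ : Finset (Fin (Module.finrank ℝ V))))]
      _ = _ := by
          simp only [hT, sq, Finset.sum_mul_sum]
  rw [h1, h2]
  calc (∑ a, T a a) ^ 2 ≤ (Module.finrank ℝ V) * ∑ a, T a a ^ 2 := by
        simpa using sq_sum_le_card_mul_sum_sq (s := Finset.univ) (f := fun a => T a a)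
    _ ≤ _ := by
        gcongr with a
        exact Finset.single_le_sum (f := fun b => T a b ^ 2) (fun b _ => sq_nonneg _)
          (Finset.mem_univ a)

/-- The weighted Welch inequality for vectors orthogonal to a given nonzero vector. -/
theorem sq_sum_mul_norm_sq_le_of_orthogonal {M : ℝ} (hM : (Module.finrank ℝ V : ℝ) ≤ M)
    {e : V} (he : e ≠ 0) (m : ι → ℝ) (hm : ∀ i, 0 ≤ m i) (y : ι → V)
    (hy : ∀ i, inner ℝ e (y i) = 0) :
    (∑ i, m i * ‖y i‖ ^ 2) ^ 2 ≤
      (M - 1) * ∑ i, ∑ j, m i * m j * inner ℝ (y i) (y j) ^ 2 := by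
  have h := sq_sum_mul_norm_sq_le (V := (Submodule.span ℝ {e})ᗮ) m
    fun i => ⟨y i, Submodule.mem_orthogonal_singleton_iff_inner_right.2 (hy i)⟩
  have h1 := Submodule.finrank_add_finrank_orthogonal (Submodule.span ℝ {e})
  rw [finrank_span_singleton he] at h1
  have h2 : (Module.finrank ℝ (Submodule.span ℝ {e})ᗮ : ℝ) ≤ M - 1 := by
    rw [← h1] at hM; push_cast at hM; linarith
  refine h.trans (mul_le_mul_of_nonneg_right h2 ?_)
  exact Finset.sum_nonneg fun i _ => Finset.sum_nonneg fun j _ =>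
    mul_nonneg (mul_nonneg (hm i) (hm j)) (sq_nonneg _)

end Welch

/-! ### Energy of isotropic measures -/

section Simplex

variable {ι V : Type*} [Fintype ι] [NormedAddCommGroup V] [InnerProductSpace ℝ V]
  [FiniteDimensional ℝ V]

/-- Among isotropic probability measures on unit vectors `x` with `⟪e, x⟫ = 1`, `‖e‖ ^ 2 = k`, the
energy `∑ ⟪x i, x j⟫ ^ r` is at most that of a simplex with `M` vertices and inner products `b`. -/
theorem sum_inner_rpow_le_simplex {M k b r : ℝ} (hM : (Module.finrank ℝ V : ℝ) ≤ M) (hM1 : 1 ≤ M)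
    (hk : 0 < k) (hb0 : 0 < b) (hb1 : b < 1) (hkb : 1 / k = b + (1 - b) / M)
    (hr0 : 0 < r) (hr1 : r ≤ 1) {e : V} (he : ‖e‖ ^ 2 = k) (m : ι → ℝ) (hm : ∀ i, 0 ≤ m i)
    (hm1 : ∑ i, m i = 1) (x : ι → V) (hx1 : ∀ i, m i ≠ 0 → ‖x i‖ = 1)
    (hxe : ∀ i, m i ≠ 0 → inner ℝ e (x i) = 1) (hx0 : ∀ i j, 0 ≤ inner ℝ (x i) (x j))
    (hiso : ∑ i, m i • x i = (1 / k) • e) :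
    ∑ i, ∑ j, m i * m j * inner ℝ (x i) (x j) ^ r ≤ b ^ r + 1 / M * (1 - b ^ r) := by
  obtain ⟨l, c, hc, h1, hle⟩ := exists_quadratic_majorant_rpow hr0 hr1 hb0 hb1
  have hMp : 0 < M := by linarith
  set s : ι → ι → ℝ := fun i j => inner ℝ (x i) (x j) with hs
  have hS1 : ∑ i, ∑ j, m i * m j * s i j = 1 / k := by
    have : inner ℝ (∑ i, m i • x i) (∑ j, m j • x j) = 1 / k := by
      rw [hiso, inner_smul_left, inner_smul_right, real_inner_self_eq_norm_sq, he]
      simp; field_simp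
    rw [← this, sum_inner]
    refine Finset.sum_congr rfl fun i _ => ?_
    rw [inner_sum]
    refine Finset.sum_congr rfl fun j _ => ?_
    rw [inner_smul_left, inner_smul_right]
    simp [hs]; ring
  set S2 : ℝ := ∑ i, ∑ j, m i * m j * s i j ^ 2 with hS2
  -- Averaging the majorant leaves only the first two moments of `s`. The second enters with
  -- coefficient `-c ≤ 0`, so it must be bounded from below.
  have hupper : ∑ i, ∑ j, m i * m j * s i j ^ r ≤
      b ^ r + l * (1 / k - b) - c * (S2 - 2 * b * (1 / k) + b ^ 2) := by
    calc _ ≤ ∑ i, ∑ j, m i * m j * (b ^ r + l * (s i j - b) - c * (s i j - b) ^ 2) := by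
          refine Finset.sum_le_sum fun i _ => Finset.sum_le_sum fun j _ => ?_
          by_cases hi : m i = 0
          · simp [hi]
          by_cases hj : m j = 0
          · simp [hj]
          refine mul_le_mul_of_nonneg_left (hle _ ⟨hx0 i j, ?_⟩) (mul_nonneg (hm i) (hm j))
          have := real_inner_le_norm (x i) (x j)
          rwa [hx1 i hi, hx1 j hj, one_mul] at this
      _ = ∑ i, ∑ j, ((b ^ r - l * b - c * b ^ 2) * (m i * m j) +
            (l + 2 * c * b) * (m i * m j * s i j) - c * (m i * m j * s i j ^ 2)) := by
          refine Finset.sum_congr rfl fun i _ => Finset.sum_congr rfl fun j _ => ?_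
          ring
      _ = _ := by
          simp only [Finset.sum_add_distrib, Finset.sum_sub_distrib, ← Finset.mul_sum]
          simp only [hm1, mul_one]
          rw [hS1, ← hS2]
          ring
  have hvar : ∑ i, ∑ j, m i * m j * (s i j - 1 / k) ^ 2 = S2 - (1 / k) ^ 2 := by
    calc _ = ∑ i, ∑ j, (m i * m j * s i j ^ 2 - 2 * (1 / k) * (m i * m j * s i j) +
          (1 / k) ^ 2 * (m i * m j)) := by
          refine Finset.sum_congr rfl fun i _ => Finset.sum_congr rfl fun j _ => ?_
          ring
      _ = _ := by
          simp only [Finset.sum_add_distrib, Finset.sum_sub_distrib, ← Finset.mul_sum]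
          simp only [hm1, mul_one]
          rw [hS1, ← hS2]
          ring
  have hwelch : (1 - 1 / k) ^ 2 ≤ (M - 1) * (S2 - (1 / k) ^ 2) := by
    have he0 : e ≠ 0 := by
      rintro rfl
      simp at he
      linarith
    have h := sq_sum_mul_norm_sq_le_of_orthogonal hM he0 m hm
      -- The coefficient is `1 / k` wherever the mass is nonzero; this form keeps orthogonality to
      -- `e` at the massless points too.
      (fun i => x i - (inner ℝ e (x i) / k) • e) (fun i => by
        rw [inner_sub_right, inner_smul_right, real_inner_self_eq_norm_sq, he]
        field_simp; ring)
    have hin : ∀ i j, m i ≠ 0 → m j ≠ 0 →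
        inner ℝ (x i - (inner ℝ e (x i) / k) • e) (x j - (inner ℝ e (x j) / k) • e) =
          s i j - 1 / k := by
      intro i j hi hj
      rw [hxe i hi, hxe j hj, inner_sub_left, inner_sub_right, inner_sub_right, inner_smul_left,
        inner_smul_left, inner_smul_right, inner_smul_right, real_inner_self_eq_norm_sq, he,
        real_inner_comm e (x i), hxe i hi, hxe j hj]
      simp only [hs, conj_trivial]
      field_simp
      ring
    have h2 : ∑ i, m i * ‖x i - (inner ℝ e (x i) / k) • e‖ ^ 2 = 1 - 1 / k := by
      trans (∑ i, m i) * (1 - 1 / k)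
      swap
      · rw [hm1, one_mul]
      rw [Finset.sum_mul]
      refine Finset.sum_congr rfl fun i _ => ?_
      by_cases hi : m i = 0
      · simp [hi]
      rw [← real_inner_self_eq_norm_sq, hin i i hi hi, hs]
      simp only
      rw [real_inner_self_eq_norm_sq, hx1 i hi, one_pow]
    rw [h2] at h
    refine h.trans (le_of_eq ?_)
    rw [← hvar]
    congr 1
    refine Finset.sum_congr rfl fun i _ => Finset.sum_congr rfl fun j _ => ?_
    by_cases hi : m i = 0
    · simp [hi]
    by_cases hj : m j = 0
    · simp [hj]
    rw [hin i j hi hj]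
  have hvar0 : 0 ≤ S2 - (1 / k) ^ 2 := by
    rw [← hvar]
    exact Finset.sum_nonneg fun i _ => Finset.sum_nonneg fun j _ =>
      mul_nonneg (mul_nonneg (hm i) (hm j)) (sq_nonneg _)
  have hlower : (1 - b) ^ 2 / M ≤ S2 - 2 * b * (1 / k) + b ^ 2 := by
    -- For `M = 1` Welch is vacuous, but then `1 / k = 1` and nonnegativity of the variance
    -- suffices.
    rcases hM1.eq_or_lt with hM1 | hM1
    · rw [← hM1] at hkb ⊢
      rw [hkb] at hvar0 ⊢
      linarith
    · have h3 : (1 - 1 / k) ^ 2 / (M - 1) ≤ S2 - (1 / k) ^ 2 := by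
        rw [div_le_iff₀ (by linarith)]
        linarith
      -- For the simplex distribution (mass `1 / M` at `1`, the rest at `b`), the second moment
      -- about `b` is the variance plus the squared shift of the mean.
      have h4 : (1 - b) ^ 2 / M = (1 - 1 / k) ^ 2 / (M - 1) + (1 / k - b) ^ 2 := by
        have : M - 1 ≠ 0 := by linarith
        rw [hkb]
        field_simp
        ring
      rw [h4]
      linarith
  refine hupper.trans ?_
  have h5 := mul_le_mul_of_nonneg_left hlower hc
  have h6 : 1 / M * (1 - b ^ r) = l * ((1 - b) / M) - c * ((1 - b) ^ 2 / M) := by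
    have : 1 - b ^ r = l * (1 - b) - c * (1 - b) ^ 2 := by linarith
    rw [this]; ring
  have h7 : 1 / k - b = (1 - b) / M := by linarith
  rw [h6, h7]
  linarith

/-- The energy bound for a weighted decomposition `e = ∑ c i • P i`, where `⟪P i, P j⟫ = B i j ^ 2`
and the weights are `c i = l i ^ (q / 2 - 1)` for the traces `l i = ⟪e, P i⟫ = B i i`. -/
theorem sum_rpow_le_simplex_of_decomposition {M k b q : ℝ} (hM : (Module.finrank ℝ V : ℝ) ≤ M)
    (hM1 : 1 ≤ M) (hk : 0 < k) (hb0 : 0 < b) (hb1 : b < 1) (hkb : 1 / k = b + (1 - b) / M)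
    (hq0 : 0 < q) (hq2 : q ≤ 2) {e : V} (he : ‖e‖ ^ 2 = k) {c l : ι → ℝ} {P : ι → V}
    {B : ι → ι → ℝ} (hc : ∀ i, 0 < c i) (hB0 : ∀ i j, 0 ≤ B i j) (hBl : ∀ i, B i i = l i)
    (hP : ∀ i j, inner ℝ (P i) (P j) = B i j ^ 2) (hPe : ∀ i, inner ℝ e (P i) = l i)
    (hsum : ∑ i, c i • P i = e) (hl : ∀ i, c i * l i = l i ^ (q / 2)) :
    ∑ i, ∑ j, B i j ^ q ≤ k ^ 2 * (b ^ (q / 2) + 1 / M * (1 - b ^ (q / 2))) := by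
  have hl0 : ∀ i, 0 ≤ l i := fun i => hBl i ▸ hB0 i i
  have hzero : ∀ i, l i = 0 → P i = 0 := fun i hi => by
    rw [← inner_self_eq_zero (𝕜 := ℝ), hP, hBl, hi, sq, zero_mul]
  have hcl : ∑ i, c i * l i = k := by
    rw [← he, ← real_inner_self_eq_norm_sq]
    nth_rw 2 [← hsum]
    rw [inner_sum]
    refine Finset.sum_congr rfl fun i _ => ?_
    rw [real_inner_smul_right, hPe]
  have hin : ∀ i j, inner ℝ ((l i)⁻¹ • P i) ((l j)⁻¹ • P j) =
      (l i)⁻¹ * (l j)⁻¹ * B i j ^ 2 := fun i j => by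
    rw [real_inner_smul_left, real_inner_smul_right, hP, mul_assoc]
  have hml : ∀ i, c i * l i / k ≠ 0 → l i ≠ 0 := by
    rintro i h h0
    simp [h0] at h
  have h := sum_inner_rpow_le_simplex (r := q / 2) hM hM1 hk hb0 hb1 hkb (by linarith)
    (by linarith) he (fun i => c i * l i / k)
    (fun i => div_nonneg (mul_nonneg (hc i).le (hl0 i)) hk.le)
    (by rw [← Finset.sum_div, hcl, div_self hk.ne'])
    (fun i => (l i)⁻¹ • P i) (fun i hi => by
      have h2 := hin i i
      rw [real_inner_self_eq_norm_sq, hBl, ← sq, ← mul_pow, inv_mul_cancel₀ (hml i hi)] at h2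
      exact (pow_left_inj₀ (norm_nonneg _) zero_le_one two_ne_zero).1 h2)
    (fun i hi => by rw [real_inner_smul_right, hPe, inv_mul_cancel₀ (hml i hi)])
    (fun i j => by
      rw [hin]
      exact mul_nonneg (mul_nonneg (inv_nonneg.2 (hl0 i)) (inv_nonneg.2 (hl0 j))) (sq_nonneg _))
    (by
      rw [← hsum, Finset.smul_sum]
      refine Finset.sum_congr rfl fun i _ => ?_
      by_cases hi : l i = 0
      · rw [hzero i hi]
        simp
      · rw [smul_smul, smul_smul]
        congr 1
        field_simp)
  -- The Lewis relation `hl` turns the masses into `l i ^ (q / 2) / k`, which cancels the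
  -- normalisation of `P i` exactly.
  have hterm : ∀ i j, c i * l i / k * (c j * l j / k) *
      inner ℝ ((l i)⁻¹ • P i) ((l j)⁻¹ • P j) ^ (q / 2) = B i j ^ q / k ^ 2 := by
    intro i j
    by_cases hi : l i = 0
    · have h0 : B i j = 0 := by
        have := hP i j
        rw [hzero i hi, inner_zero_left] at this
        exact pow_eq_zero_iff two_ne_zero |>.1 this.symm
      simp [hi, h0, Real.zero_rpow hq0.ne']
    by_cases hj : l j = 0
    · have h0 : B i j = 0 := by
        have := hP i j
        rw [hzero j hj, inner_zero_right] at this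
        exact pow_eq_zero_iff two_ne_zero |>.1 this.symm
      simp [hj, h0, Real.zero_rpow hq0.ne']
    have hi' := lt_of_le_of_ne (hl0 i) (Ne.symm hi)
    have hj' := lt_of_le_of_ne (hl0 j) (Ne.symm hj)
    have h1 : l i ^ (q / 2) ≠ 0 := (Real.rpow_pos_of_pos hi' _).ne'
    have h2 : l j ^ (q / 2) ≠ 0 := (Real.rpow_pos_of_pos hj' _).ne'
    have e2 : (B i j ^ 2) ^ (q / 2) = B i j ^ q := by
      rw [← Real.rpow_natCast_mul (hB0 i j)]
      congr 1
      push_cast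
      ring
    rw [hin, hl i, hl j, Real.mul_rpow (by positivity) (by positivity),
      Real.mul_rpow (by positivity) (by positivity), Real.inv_rpow (hl0 i), Real.inv_rpow (hl0 j),
      e2]
    field_simp
  simp only [hterm, ← Finset.sum_div] at h
  rw [div_le_iff₀ (by positivity)] at h
  linarith

end Simplex

/-! ### Real, complex and quaternionic scalars -/

/-- The common structure of `ℝ`, `ℂ` and `ℍ[ℝ]`: a division ring with an involution and a real inner
product `⟪x, y⟫ = Re (star x * y)` for which the norm is multiplicative. -/
class EuclideanDivisionRing (K : Type*) [NormedDivisionRing K] [StarRing K]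
    [InnerProductSpace ℝ K] : Prop extends IsScalarTower ℝ K K, SMulCommClass ℝ K K,
    StarModule ℝ K where
  star_mul_self_eq (a : K) : star a * a = (‖a‖ ^ 2) • (1 : K)
  inner_mul_left_eq (a x y : K) : inner ℝ (a * x) y = inner ℝ x (star a * y)
  inner_mul_right_eq (a x y : K) : inner ℝ (x * a) y = inner ℝ x (y * star a)

instance : EuclideanDivisionRing ℝ where
  star_mul_self_eq a := by simp [sq]
  inner_mul_left_eq a x y := by simp; ring
  inner_mul_right_eq a x y := by simp; ring

instance : EuclideanDivisionRing ℂ where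
  star_mul_self_eq a := by
    simp [← Complex.normSq_eq_norm_sq, Complex.normSq_eq_conj_mul_self]
  inner_mul_left_eq a x y := by simp [Complex.inner]; ring
  inner_mul_right_eq a x y := by simp [Complex.inner]; ring

instance : EuclideanDivisionRing ℍ[ℝ] where
  star_mul_self_eq a := by
    rw [Quaternion.star_mul_self, Quaternion.normSq_eq_norm_mul_self, ← sq]
    generalize ‖a‖ ^ 2 = r
    ext <;> simp
  star_smul r a := by ext <;> simp
  inner_mul_left_eq a x y := by simp [Quaternion.inner_def]; ring
  inner_mul_right_eq a x y := by simp [Quaternion.inner_def]; ring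

namespace EuclideanDivisionRing

variable {K : Type*} [NormedDivisionRing K] [StarRing K] [InnerProductSpace ℝ K]
  [EuclideanDivisionRing K]

theorem norm_star_eq (a : K) : ‖star a‖ = ‖a‖ := by
  by_cases ha : a = 0
  · simp [ha]
  have h := congrArg norm (star_mul_self_eq a)
  rw [norm_mul, norm_smul, norm_one, mul_one, norm_pow, norm_norm, sq] at h
  exact mul_right_cancel₀ (norm_ne_zero_iff.2 ha) h

theorem mul_star_self_eq (a : K) : a * star a = (‖a‖ ^ 2) • (1 : K) := by
  have h := star_mul_self_eq (star a)
  rwa [star_star, norm_star_eq] at h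

theorem inner_eq_inner_one (x y : K) : inner ℝ x y = inner ℝ 1 (star x * y) := by
  rw [← inner_mul_left_eq, mul_one]

/-- The functional `inner ℝ 1` is the real part, a trace even when `K` is noncommutative. -/
theorem inner_one_mul_comm (x y : K) : inner ℝ 1 (x * y) = inner ℝ 1 (y * x) := by
  have h1 := inner_mul_left_eq (star x) 1 y
  have h2 := inner_mul_right_eq (star x) 1 y
  rw [star_star, mul_one] at h1
  rw [star_star, one_mul] at h2
  rw [← h1, h2]

/-- Here `a ^ 2 = ‖a‖ ^ 2`, so `(a - ‖a‖) (a + ‖a‖) = 0` in a ring without zero divisors. -/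
theorem eq_smul_one_of_star_eq {a : K} (ha : star a = a) : ∃ r : ℝ, a = r • (1 : K) := by
  have h := star_mul_self_eq a
  rw [ha] at h
  have h2 : (a - ‖a‖ • (1 : K)) * (a + ‖a‖ • (1 : K)) = 0 := by
    simp only [sub_mul, mul_add, h, mul_smul_comm, smul_mul_assoc, one_mul, mul_one, smul_sub,
      smul_smul, sq]
    abel
  rcases mul_eq_zero.1 h2 with h | h
  · exact ⟨‖a‖, sub_eq_zero.1 h⟩
  · exact ⟨-‖a‖, by rw [neg_smul]; exact eq_neg_of_add_eq_zero_left h⟩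

end EuclideanDivisionRing

/-! ### Right vector spaces -/

section RightFinrank

variable (K : Type*) [DivisionRing K]

/-- A division ring as a right vector space over itself. -/
def rightSelfEquiv : Kᵐᵒᵖ ≃ₗ[Kᵐᵒᵖ] K where
  toFun := MulOpposite.unop
  invFun := MulOpposite.op
  map_add' _ _ := rfl
  map_smul' _ _ := rfl
  left_inv _ := rfl
  right_inv _ := rfl

instance finite_right_self : Module.Finite Kᵐᵒᵖ K := Module.Finite.equiv (rightSelfEquiv K)

theorem finrank_right_pi (ι : Type*) [Fintype ι] :
    Module.finrank Kᵐᵒᵖ (ι → K) = Fintype.card ι := by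
  rw [Module.finrank_pi_fintype, ← (rightSelfEquiv K).finrank_eq]
  simp

end RightFinrank

/-! ### Weighted forms, orthonormal bases and leverages -/

section WeightedForm

open EuclideanDivisionRing

variable {K : Type*} [NormedDivisionRing K] [StarRing K] [InnerProductSpace ℝ K]
  [EuclideanDivisionRing K] {ι : Type*} [Fintype ι]

/-- The form `y ↦ ∑ i, c i • (star (x i) * y i)`. -/
def weightedForm (c : ι → ℝ) (x : ι → K) : (ι → K) →ₗ[Kᵐᵒᵖ] K where
  toFun y := ∑ i, c i • (star (x i) * y i)
  map_add' y z := by simp [mul_add, Finset.sum_add_distrib]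
  map_smul' s y := by
    simp only [Pi.smul_apply, MulOpposite.smul_eq_mul_unop, RingHom.id_apply, Finset.sum_mul,
      smul_mul_assoc, mul_assoc]

theorem weightedForm_apply (c : ι → ℝ) (x y : ι → K) :
    weightedForm c x y = ∑ i, c i • (star (x i) * y i) := rfl

theorem star_weightedForm (c : ι → ℝ) (x y : ι → K) :
    star (weightedForm c x y) = weightedForm c y x := by
  simp [weightedForm_apply]

theorem weightedForm_self (c : ι → ℝ) (x : ι → K) :
    weightedForm c x x = (∑ i, c i * ‖x i‖ ^ 2) • (1 : K) := by
  simp [weightedForm_apply, star_mul_self_eq, Finset.sum_smul, smul_smul]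

/-- A family orthonormal for the weighted form. -/
def IsWeightedOrthonormal (c : ι → ℝ) {n : ℕ} (f : Fin n → ι → K) : Prop :=
  ∀ a b, weightedForm c (f a) (f b) = if a = b then 1 else 0

theorem IsWeightedOrthonormal.form_sum {c : ι → ℝ} {n : ℕ} {f : Fin n → ι → K}
    (hf : IsWeightedOrthonormal c f) (a : Fin n) (g : Fin n → Kᵐᵒᵖ) :
    weightedForm c (f a) (∑ b, g b • f b) = (g a).unop := by
  rw [map_sum, Finset.sum_eq_single a]
  · rw [map_smul, hf, if_pos rfl, MulOpposite.smul_eq_mul_unop, one_mul]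
  · intro b _ hb
    rw [map_smul, hf, if_neg hb.symm, smul_zero]
  · simp

theorem IsWeightedOrthonormal.linearIndependent {c : ι → ℝ} {n : ℕ} {f : Fin n → ι → K}
    (hf : IsWeightedOrthonormal c f) : LinearIndependent Kᵐᵒᵖ f := by
  refine Fintype.linearIndependent_iff.2 fun g hg a => ?_
  have h := hf.form_sum a g
  rw [hg, map_zero] at h
  exact (MulOpposite.unop_eq_zero_iff _).1 h.symm

/-- One Gram–Schmidt step. The normalising scalar is real, so noncommutativity causes no trouble. -/
theorem IsWeightedOrthonormal.exists_extend {c : ι → ℝ} (hc : ∀ i, 0 < c i) {n : ℕ}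
    {f : Fin n → ι → K} (hf : IsWeightedOrthonormal c f) {U : Submodule Kᵐᵒᵖ (ι → K)}
    (hfU : ∀ a, f a ∈ U) {x : ι → K} (hx : x ∈ U)
    (hne : x ≠ ∑ a, MulOpposite.op (weightedForm c (f a) x) • f a) :
    ∃ g : Fin (n + 1) → ι → K, IsWeightedOrthonormal c g ∧ ∀ a, g a ∈ U := by
  set y := x - ∑ a, MulOpposite.op (weightedForm c (f a) x) • f a with hy
  have hyU : y ∈ U := U.sub_mem hx (U.sum_mem fun a _ => U.smul_mem _ (hfU a))
  have hfy : ∀ a, weightedForm c (f a) y = 0 := fun a => by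
    rw [hy, map_sub, hf.form_sum, MulOpposite.unop_op, sub_self]
  have hy0 : y ≠ 0 := sub_ne_zero.2 hne
  set s : ℝ := ∑ i, c i * ‖y i‖ ^ 2 with hs
  have hspos : 0 < s := by
    obtain ⟨i, hi⟩ := Function.ne_iff.1 hy0
    refine Finset.sum_pos' (fun j _ => mul_nonneg (hc j).le (sq_nonneg _))
      ⟨i, Finset.mem_univ i, mul_pos (hc i) (pow_pos (norm_pos_iff.2 hi) 2)⟩
  set t : Kᵐᵒᵖ := MulOpposite.op ((Real.sqrt s)⁻¹ • (1 : K)) with ht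
  have hfz : ∀ a, weightedForm c (f a) (t • y) = 0 := fun a => by
    rw [map_smul, hfy, smul_zero]
  have hzz : weightedForm c (t • y) (t • y) = 1 := by
    rw [weightedForm_self]
    have h1 : ∀ i, c i * ‖(t • y) i‖ ^ 2 = s⁻¹ * (c i * ‖y i‖ ^ 2) := fun i => by
      rw [Pi.smul_apply, MulOpposite.smul_eq_mul_unop, norm_mul, ht, MulOpposite.unop_op, norm_smul,
        norm_one, mul_one, mul_pow, norm_inv, inv_pow, Real.norm_eq_abs, sq_abs,
        Real.sq_sqrt hspos.le]
      ring
    rw [Finset.sum_congr rfl fun i _ => h1 i, ← Finset.mul_sum, ← hs,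
      inv_mul_cancel₀ hspos.ne', one_smul]
  refine ⟨Fin.cons (t • y) f, fun a b => ?_, fun a => ?_⟩
  · refine Fin.cases ?_ (fun a => ?_) a <;> refine Fin.cases ?_ (fun b => ?_) b
    · simpa using hzz
    · simp only [Fin.cons_zero, Fin.cons_succ]
      rw [← star_weightedForm, hfz, star_zero, if_neg (Fin.succ_ne_zero b).symm]
    · simp only [Fin.cons_zero, Fin.cons_succ]
      rw [hfz, if_neg (Fin.succ_ne_zero a)]
    · simpa using hf a b
  · refine Fin.cases ?_ (fun a => ?_) a
    · exact U.smul_mem _ hyU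
    · exact hfU a

theorem exists_weightedOrthonormal_basis {c : ι → ℝ} (hc : ∀ i, 0 < c i)
    (U : Submodule Kᵐᵒᵖ (ι → K)) {k : ℕ} (hk : Module.finrank Kᵐᵒᵖ U = k) :
    ∃ f : Fin k → ι → K, IsWeightedOrthonormal c f ∧ (∀ a, f a ∈ U) ∧
      ∀ x ∈ U, x = ∑ a, MulOpposite.op (weightedForm c (f a) x) • f a := by
  set P : ℕ → Prop := fun n =>
    ∃ f : Fin n → ι → K, IsWeightedOrthonormal c f ∧ ∀ a, f a ∈ U with hP
  have hle : ∀ n, P n → n ≤ k := by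
    rintro n ⟨f, hf, hfU⟩
    have h := (LinearIndependent.of_comp U.subtype
      (v := fun a => (⟨f a, hfU a⟩ : U)) hf.linearIndependent).fintype_card_le_finrank
    rwa [Fintype.card_fin, hk] at h
  -- A family that cannot be lengthened must span `U`, since otherwise Gram–Schmidt would extend it.
  obtain ⟨n, ⟨f, hf, hfU⟩, hn⟩ : ∃ n, P n ∧ ¬ P (n + 1) := by
    by_contra! h
    have hall : ∀ n, P n := fun n => by
      induction n with
      | zero => exact ⟨fun a => a.elim0, fun a => a.elim0, fun a => a.elim0⟩
      | succ n ih => exact h n ih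
    exact absurd (hle _ (hall (k + 1))) (by omega)
  have hspan : ∀ x ∈ U, x = ∑ a, MulOpposite.op (weightedForm c (f a) x) • f a := by
    intro x hx
    by_contra hne
    exact hn (hf.exists_extend hc hfU hx hne)
  have hkn : k ≤ n := by
    have h1 : U ≤ Submodule.span Kᵐᵒᵖ (Set.range f) := fun x hx => by
      rw [hspan x hx]
      exact Submodule.sum_mem _ fun a _ =>
        Submodule.smul_mem _ _ (Submodule.subset_span (Set.mem_range_self a))
    have h2 := (Submodule.finrank_mono h1).trans (finrank_range_le_card f)
    rwa [Fintype.card_fin, hk] at h2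
  obtain rfl : n = k := le_antisymm (hle n ⟨f, hf, hfU⟩) hkn
  exact ⟨f, hf, hfU, hspan⟩

theorem IsWeightedOrthonormal.sum_norm_sq {c : ι → ℝ} {n : ℕ} {f : Fin n → ι → K}
    (hf : IsWeightedOrthonormal c f) (g : Fin n → Kᵐᵒᵖ) :
    ∑ i, c i * ‖(∑ a, g a • f a) i‖ ^ 2 = ∑ a, ‖(g a).unop‖ ^ 2 := by
  have h1 := weightedForm_self c (∑ a, g a • f a)
  rw [map_sum] at h1
  have h2 : ∀ a, weightedForm c (∑ b, g b • f b) (g a • f a) = (‖(g a).unop‖ ^ 2) • (1 : K) := by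
    intro a
    rw [map_smul, ← star_weightedForm, hf.form_sum, MulOpposite.smul_eq_mul_unop, star_mul_self_eq]
  rw [Finset.sum_congr rfl fun a _ => h2 a, ← Finset.sum_smul] at h1
  exact (smul_left_injective ℝ (one_ne_zero (α := K)) h1).symm

/-- The leverage of a coordinate is the least constant bounding its square by the weighted norm. -/
theorem IsWeightedOrthonormal.norm_sq_apply_le {c : ι → ℝ} {n : ℕ} {f : Fin n → ι → K}
    (hf : IsWeightedOrthonormal c f) (g : Fin n → Kᵐᵒᵖ) (i : ι) :
    ‖(∑ a, g a • f a) i‖ ^ 2 ≤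
      (∑ a, ‖f a i‖ ^ 2) * ∑ j, c j * ‖(∑ a, g a • f a) j‖ ^ 2 := by
  rw [hf.sum_norm_sq]
  refine le_trans ?_ (Finset.sum_mul_sq_le_sq_mul_sq Finset.univ
    (fun a => ‖f a i‖) (fun a => ‖(g a).unop‖))
  refine pow_le_pow_left₀ (norm_nonneg _) ?_ 2
  rw [Finset.sum_apply]
  refine (norm_sum_le _ _).trans (le_of_eq ?_)
  simp [MulOpposite.smul_eq_mul_unop]

/-- The leverage at `i` is the supremum of `‖x i‖ ^ 2` over the weighted square norm of `x ∈ U`,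
hence monotone in the weights. The test vector is the reproducing vector of coordinate `i` for `c'`.
-/
theorem leverage_le_mul_leverage {c c' : ι → ℝ} {n n' : ℕ} {f : Fin n → ι → K}
    {f' : Fin n' → ι → K} (hf : IsWeightedOrthonormal c f) (hf' : IsWeightedOrthonormal c' f')
    {U : Submodule Kᵐᵒᵖ (ι → K)} (hfU' : ∀ a, f' a ∈ U)
    (hspan : ∀ x ∈ U, x = ∑ a, MulOpposite.op (weightedForm c (f a) x) • f a)
    {r : ℝ} (hr : 0 ≤ r) (hcc : ∀ i, c i ≤ r * c' i) (i : ι) :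
    ∑ a, ‖f' a i‖ ^ 2 ≤ r * ∑ a, ‖f a i‖ ^ 2 := by
  set l : ℝ := ∑ a, ‖f a i‖ ^ 2 with hl
  set l' : ℝ := ∑ a, ‖f' a i‖ ^ 2 with hl'
  have hl0 : 0 ≤ l := Finset.sum_nonneg fun _ _ => sq_nonneg _
  have hl0' : 0 ≤ l' := Finset.sum_nonneg fun _ _ => sq_nonneg _
  set x : ι → K := ∑ a, MulOpposite.op (star (f' a i)) • f' a with hx
  have hxU : x ∈ U := U.sum_mem fun a _ => U.smul_mem _ (hfU' a)
  have hxi : ‖x i‖ ^ 2 = l' ^ 2 := by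
    rw [hx, Finset.sum_apply]
    simp only [Pi.smul_apply, MulOpposite.smul_eq_mul_unop, MulOpposite.unop_op, mul_star_self_eq]
    rw [← Finset.sum_smul, norm_smul, norm_one, mul_one, ← hl', Real.norm_eq_abs, sq_abs]
  have hxn' : ∑ j, c' j * ‖x j‖ ^ 2 = l' := by
    rw [hx, hf'.sum_norm_sq]
    simp only [MulOpposite.unop_op, norm_star_eq]
    rfl
  have hxn : ∑ j, c j * ‖x j‖ ^ 2 ≤ r * l' := by
    rw [← hxn', Finset.mul_sum]
    refine Finset.sum_le_sum fun j _ => ?_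
    rw [← mul_assoc]
    exact mul_le_mul_of_nonneg_right (hcc j) (sq_nonneg _)
  have h := hf.norm_sq_apply_le (fun a => MulOpposite.op (weightedForm c (f a) x)) i
  rw [← hspan x hxU, hxi] at h
  have h2 : l' ^ 2 ≤ l * (r * l') := h.trans (mul_le_mul_of_nonneg_left hxn hl0)
  rcases hl0'.eq_or_lt with h0 | h0
  · rw [← h0]
    positivity
  · nlinarith

end WeightedForm

/-! ### Lewis weights by a contraction -/

section LewisPosition

variable {K : Type*} [NormedDivisionRing K] [StarRing K] [InnerProductSpace ℝ K]
  [EuclideanDivisionRing K] {ι : Type*} [Fintype ι]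

/-- Lewis' change of density: a subspace has weights `c` and a `c`-orthonormal basis such that
`c i * l i = l i ^ (q / 2)`, where `l i` is the square sum of the `i`-th coordinates of the basis. -/
theorem exists_lewis_weights (U : Submodule Kᵐᵒᵖ (ι → K)) {k : ℕ}
    (hk : Module.finrank Kᵐᵒᵖ U = k) {q : ℝ} (hq0 : 0 < q) (hq2 : q ≤ 2) :
    ∃ (c : ι → ℝ) (f : Fin k → ι → K), (∀ i, 0 < c i) ∧ IsWeightedOrthonormal c f ∧
      (∀ a, f a ∈ U) ∧ ∀ i, c i * ∑ a, ‖f a i‖ ^ 2 = (∑ a, ‖f a i‖ ^ 2) ^ (q / 2) := by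
  have hpos : ∀ (y : ι → ℝ) i, 0 < Real.exp (y i) := fun y i => Real.exp_pos _
  choose F hF hFU hFspan using fun y : ι → ℝ =>
    exists_weightedOrthonormal_basis (c := fun i => Real.exp (y i)) (hpos y) U hk
  set l : (ι → ℝ) → ι → ℝ := fun y i => ∑ a, ‖F y a i‖ ^ 2 with hl
  have hl0 : ∀ y i, 0 ≤ l y i := fun y i => Finset.sum_nonneg fun _ _ => sq_nonneg _
  have hle : ∀ y z i, l z i ≤ Real.exp (dist y z) * l y i := fun y z i =>
    leverage_le_mul_leverage (hF y) (hF z) (hFU z) (hFspan y) (Real.exp_pos _).le (fun j => by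
      rw [← Real.exp_add, Real.exp_le_exp]
      have h1 := dist_le_pi_dist y z j
      have h2 := le_abs_self (y j - z j)
      rw [Real.dist_eq] at h1
      linarith) i
  -- Logarithms of leverages are 1-Lipschitz in the log-weights. A leverage that vanishes for one
  -- weight vanishes for all, and then `Real.log 0 = 0` makes the difference zero.
  have hlog : ∀ y z i, Real.log (l z i) - Real.log (l y i) ≤ dist y z := by
    intro y z i
    rcases (hl0 z i).eq_or_lt with hz | hz
    · have h := hle z y i
      rw [← hz, mul_zero] at h
      rw [← hz, le_antisymm h (hl0 y i)]
      simp
    · have hy : 0 < l y i := by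
        by_contra! h
        have h' := hle y z i
        rw [le_antisymm h (hl0 y i), mul_zero] at h'
        linarith
      have h := Real.log_le_log hz (hle y z i)
      rw [Real.log_mul (Real.exp_ne_zero _) hy.ne', Real.log_exp] at h
      linarith
  -- With `c = exp y`, the Lewis relation reads `y i = (q / 2 - 1) * log (l i)`: a fixed point of a
  -- map of Lipschitz constant `1 - q / 2 < 1`.
  have hcontr : ContractingWith (Real.toNNReal (1 - q / 2))
      (fun (y : ι → ℝ) i => Real.log (l y i) * ((q - 2) / 2)) := by
    refine ⟨by rw [← NNReal.coe_lt_coe, Real.coe_toNNReal _ (by linarith), NNReal.coe_one]; linarith,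
      LipschitzWith.of_dist_le_mul fun y z => ?_⟩
    rw [Real.coe_toNNReal _ (by linarith)]
    refine (dist_pi_le_iff (mul_nonneg (by linarith) dist_nonneg)).2 fun i => ?_
    have h1 : |Real.log (l y i) - Real.log (l z i)| ≤ dist y z :=
      abs_sub_le_iff.2 ⟨by rw [dist_comm]; exact hlog z y i, hlog y z i⟩
    rw [Real.dist_eq, ← sub_mul, abs_mul, abs_of_nonpos (by linarith : (q - 2) / 2 ≤ 0), mul_comm,
      show -((q - 2) / 2) = 1 - q / 2 by ring]
    exact mul_le_mul_of_nonneg_left h1 (by linarith)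
  set y := ContractingWith.fixedPoint _ hcontr with hy
  have hfix : ∀ i, Real.log (l y i) * ((q - 2) / 2) = y i :=
    congrFun hcontr.fixedPoint_isFixedPt
  refine ⟨fun i => Real.exp (y i), F y, hpos y, hF y, hFU y, fun i => ?_⟩
  change Real.exp (y i) * l y i = l y i ^ (q / 2)
  rcases (hl0 y i).eq_or_lt with h | h
  · rw [← h, mul_zero, Real.zero_rpow (by linarith)]
  · rw [← hfix i, ← Real.rpow_def_of_pos h, ← Real.rpow_add_one h.ne']
    congr 1
    ring

end LewisPosition

/-! ### Hermitian matrices and the kernel energy -/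

section Hermitian

open EuclideanDivisionRing

variable (K : Type*) [NormedDivisionRing K] [StarRing K] [InnerProductSpace ℝ K]
  [EuclideanDivisionRing K]

/-- The real Euclidean space of Hermitian `k × k` matrices over `K`. -/
def hermitianSpace (k : ℕ) : Submodule ℝ (PiLp 2 fun _ : Fin k × Fin k => K) where
  carrier := {H | ∀ a b, H (b, a) = star (H (a, b))}
  add_mem' hx hy a b := by simp [hx a b, hy a b]
  zero_mem' a b := by simp
  smul_mem' r x hx a b := by simp [hx a b]

/-- A Hermitian matrix is determined by its diagonal, which is real, and by its entries above the
diagonal, which `Σ b : Fin k, Fin b` indexes. -/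
theorem finrank_hermitianSpace_le [FiniteDimensional ℝ K] (k : ℕ) :
    (Module.finrank ℝ (hermitianSpace K k) : ℝ) ≤
      k + ((k : ℝ) ^ 2 - k) / 2 * Module.finrank ℝ K := by
  let D : hermitianSpace K k →ₗ[ℝ] (Fin k → Submodule.span ℝ {(1 : K)}) :=
    { toFun := fun H a => ⟨H.1 (a, a), by
        obtain ⟨r, hr⟩ := eq_smul_one_of_star_eq (H.2 a a).symm
        rw [hr]
        exact Submodule.smul_mem _ _ (Submodule.mem_span_singleton_self _)⟩
      map_add' := fun _ _ => rfl
      map_smul' := fun _ _ => rfl }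
  let E : hermitianSpace K k →ₗ[ℝ] ((Σ b : Fin k, Fin b) → K) :=
    { toFun := fun H s => H.1 (⟨s.2, s.2.2.trans s.1.2⟩, s.1)
      map_add' := fun _ _ => rfl
      map_smul' := fun _ _ => rfl }
  have hinj : Function.Injective (D.prod E) := by
    rw [injective_iff_map_eq_zero]
    intro H hH
    obtain ⟨hD, hE⟩ := Prod.ext_iff.1 hH
    have hlt : ∀ a b : Fin k, a < b → H.1 (a, b) = 0 := fun a b hab =>
      congrFun hE ⟨b, ⟨a, hab⟩⟩
    refine Subtype.ext (PiLp.ext ?_)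
    rintro ⟨a, b⟩
    rcases lt_trichotomy a b with h | rfl | h
    · exact hlt a b h
    · exact congrArg Subtype.val (congrFun hD a)
    · rw [H.2 b a, hlt b a h, star_zero]
      rfl
  have h := LinearMap.finrank_le_finrank_of_injective hinj
  rw [Module.finrank_prod, Module.finrank_pi_fintype, Module.finrank_pi_fintype] at h
  simp only [finrank_span_singleton (one_ne_zero (α := K)), Finset.sum_const, Finset.card_univ,
    Fintype.card_fin, Fintype.card_sigma, smul_eq_mul, mul_one] at h
  have h2 : (∑ b : Fin k, (b : ℕ)) * 2 = k * (k - 1) := by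
    rw [Fin.sum_univ_eq_sum_range (fun i => i), Finset.sum_range_id_mul_two]
  have h3 : ((∑ b : Fin k, (b : ℕ) : ℕ) : ℝ) = ((k : ℝ) ^ 2 - k) / 2 := by
    have h4 : ((∑ b : Fin k, (b : ℕ) : ℕ) : ℝ) * 2 = k * ((k - 1 : ℕ) : ℝ) := by exact_mod_cast h2
    rcases k.eq_zero_or_pos with rfl | hk
    · simp
    · rw [Nat.cast_sub hk] at h4
      push_cast at h4 ⊢
      linarith
  rw [← h3]
  exact_mod_cast h

variable {K}

/-- The rank one Hermitian matrix with entries `star (w a) * w b`. -/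
def rankOne {k : ℕ} (w : Fin k → K) : hermitianSpace K k :=
  ⟨WithLp.toLp 2 fun ab => star (w ab.1) * w ab.2, fun a b => by simp⟩

/-- The identity matrix as a Hermitian matrix. -/
def hermitianOne (K : Type*) [NormedDivisionRing K] [StarRing K] [InnerProductSpace ℝ K]
    [EuclideanDivisionRing K] (k : ℕ) : hermitianSpace K k :=
  ⟨WithLp.toLp 2 fun ab => if ab.1 = ab.2 then 1 else 0, fun a b => by
    by_cases h : a = b <;> simp [h, eq_comm]⟩

theorem inner_rankOne {k : ℕ} (u v : Fin k → K) :
    inner ℝ (rankOne u) (rankOne v) = ‖∑ a, u a * star (v a)‖ ^ 2 := by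
  set B := ∑ a, u a * star (v a) with hB
  have hBs : star B = ∑ b, v b * star (u b) := by simp [hB]
  calc inner ℝ (rankOne u) (rankOne v)
      = ∑ a, ∑ b, inner ℝ (star (u a) * u b) (star (v a) * v b) := by
        rw [Submodule.coe_inner, PiLp.inner_apply, Fintype.sum_prod_type]
        rfl
    -- Cyclicity of the real part regroups the factors so that the double sum splits as `B * star
    -- B`.
    _ = ∑ b, ∑ a, inner ℝ 1 ((u a * star (v a)) * (v b * star (u b))) := by
        rw [Finset.sum_comm]
        refine Finset.sum_congr rfl fun b _ => Finset.sum_congr rfl fun a _ => ?_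
        rw [inner_eq_inner_one, star_mul, star_star, mul_assoc, inner_one_mul_comm]
        simp only [mul_assoc]
    _ = inner ℝ 1 (B * star B) := by
        rw [hBs, hB, Finset.sum_mul_sum, inner_sum, Finset.sum_comm]
        simp only [inner_sum]
    _ = ‖B‖ ^ 2 := by
        rw [mul_star_self_eq, inner_smul_right, real_inner_self_eq_norm_sq, norm_one]
        simp

theorem inner_hermitianOne_rankOne {k : ℕ} (w : Fin k → K) :
    inner ℝ (hermitianOne K k) (rankOne w) = ∑ a, ‖w a‖ ^ 2 := by
  rw [Submodule.coe_inner, PiLp.inner_apply, Fintype.sum_prod_type]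
  refine Finset.sum_congr rfl fun a _ => ?_
  rw [Finset.sum_eq_single a]
  · simp only [hermitianOne, rankOne, if_true]
    rw [star_mul_self_eq, inner_smul_right, real_inner_self_eq_norm_sq, norm_one]
    simp
  · intro b _ hb
    simp [hermitianOne, hb.symm]
  · simp

theorem norm_sq_hermitianOne (k : ℕ) : ‖hermitianOne K k‖ ^ 2 = k := by
  rw [← real_inner_self_eq_norm_sq, Submodule.coe_inner, PiLp.inner_apply, Fintype.sum_prod_type]
  trans ∑ _a : Fin k, (1 : ℝ)
  · refine Finset.sum_congr rfl fun a _ => ?_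
    rw [Finset.sum_eq_single a]
    · simp [hermitianOne]
    · intro b _ hb
      simp [hermitianOne, hb.symm]
    · simp
  · simp

theorem norm_sum_mul_star_self {k : ℕ} (w : Fin k → K) :
    ‖∑ a, w a * star (w a)‖ = ∑ a, ‖w a‖ ^ 2 := by
  simp only [mul_star_self_eq]
  rw [← Finset.sum_smul, norm_smul, norm_one, mul_one,
    Real.norm_of_nonneg (Finset.sum_nonneg fun _ _ => sq_nonneg _)]

theorem IsWeightedOrthonormal.sum_smul_rankOne {ι : Type*} [Fintype ι] {c : ι → ℝ} {k : ℕ}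
    {f : Fin k → ι → K} (hf : IsWeightedOrthonormal c f) :
    ∑ i, c i • rankOne (fun a => f a i) = hermitianOne K k := by
  refine Subtype.ext (PiLp.ext ?_)
  rintro ⟨a, b⟩
  have h := hf a b
  rw [weightedForm_apply] at h
  simp only [Submodule.coe_sum, WithLp.ofLp_sum, Finset.sum_apply]
  exact h

theorem IsWeightedOrthonormal.sum_mul_leverage {ι : Type*} [Fintype ι] {c : ι → ℝ} {k : ℕ}
    {f : Fin k → ι → K} (hf : IsWeightedOrthonormal c f) :
    ∑ i, c i * ∑ a, ‖f a i‖ ^ 2 = k := by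
  have h : ∀ a, ∑ i, c i * ‖f a i‖ ^ 2 = 1 := fun a => by
    have h := hf a a
    rw [weightedForm_self, if_pos rfl] at h
    refine smul_left_injective ℝ (one_ne_zero (α := K)) ?_
    simpa using h
  simp only [Finset.mul_sum]
  rw [Finset.sum_comm, Finset.sum_congr rfl fun a _ => h a]
  simp

/-- In Lewis position, the `q`-energy of the kernel `B i j = ∑ a, f a i * star (f a j)` is at most
that of a simplex. -/
theorem sum_norm_rpow_le_simplex [FiniteDimensional ℝ K] {ι : Type*} [Fintype ι] {c : ι → ℝ}
    {k : ℕ} {f : Fin k → ι → K} (hc : ∀ i, 0 < c i) (hf : IsWeightedOrthonormal c f) {q : ℝ}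
    (hq0 : 0 < q) (hq2 : q ≤ 2)
    (hl : ∀ i, c i * ∑ a, ‖f a i‖ ^ 2 = (∑ a, ‖f a i‖ ^ 2) ^ (q / 2)) {M b : ℝ} (hk : 0 < k)
    (hM : k + ((k : ℝ) ^ 2 - k) / 2 * Module.finrank ℝ K ≤ M) (hM1 : 1 ≤ M)
    (hb0 : 0 < b) (hb1 : b < 1) (hkb : 1 / (k : ℝ) = b + (1 - b) / M) :
    ∑ i, ∑ j, ‖∑ a, f a i * star (f a j)‖ ^ q ≤
      (k : ℝ) ^ 2 * (b ^ (q / 2) + 1 / M * (1 - b ^ (q / 2))) := by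
  have hk' : (0 : ℝ) < k := by exact_mod_cast hk
  have key := @sum_rpow_le_simplex_of_decomposition ι (hermitianSpace K k) _ _ _ _ M k b q
  exact @key ((finrank_hermitianSpace_le K k).trans hM) hM1 hk' hb0 hb1 hkb hq0 hq2
    (hermitianOne K k) (norm_sq_hermitianOne k) c (fun i => ∑ a, ‖f a i‖ ^ 2)
    (fun i => rankOne fun a => f a i) (fun i j => ‖∑ a, f a i * star (f a j)‖) hc
    (fun _ _ => norm_nonneg _) (fun i => norm_sum_mul_star_self _) (fun i j => inner_rankOne _ _)
    (fun i => inner_hermitianOne_rankOne _) hf.sum_smul_rankOne hl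

end Hermitian

/-! ### Rank–nullity over the right scalars -/

section RightKernel

variable {K : Type*} [DivisionRing K] {m n : Type*} [Fintype n]

/-- Left multiplication by a matrix, as a right linear map. -/
def mulVecRight (A : Matrix m n K) : (n → K) →ₗ[Kᵐᵒᵖ] (m → K) where
  toFun v := A.mulVec v
  map_add' := A.mulVec_add
  map_smul' := A.mulVec_smul

theorem range_mulVecRight (A : Matrix m n K) :
    LinearMap.range (mulVecRight A) = Submodule.span Kᵐᵒᵖ (Set.range A.col) := by
  classical
  apply le_antisymm
  · rintro _ ⟨v, rfl⟩
    have : mulVecRight A v = ∑ j, MulOpposite.op (v j) • A.col j := by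
      funext i
      simp [mulVecRight, Matrix.mulVec, dotProduct]
    rw [this]
    exact Submodule.sum_mem _ fun j _ =>
      Submodule.smul_mem _ _ (Submodule.subset_span (Set.mem_range_self j))
  · rw [Submodule.span_le]
    rintro _ ⟨j, rfl⟩
    refine ⟨Pi.single j 1, ?_⟩
    funext i
    simp [mulVecRight]

theorem finrank_ker_mulVecRight (A : Matrix m n K) :
    Module.finrank Kᵐᵒᵖ (LinearMap.ker (mulVecRight A)) = Fintype.card n - colRank A := by
  have h := LinearMap.finrank_range_add_finrank_ker (mulVecRight A)
  rw [range_mulVecRight, finrank_right_pi] at h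
  unfold colRank
  omega

end RightKernel

/-! ### Duality, Jensen and the final bound -/

section FinalEstimate

variable {K : Type*} [NormedDivisionRing K] [StarRing K] [InnerProductSpace ℝ K]
  [EuclideanDivisionRing K]

/-- If every `f a` lies in the right kernel of a matrix with unit diagonal, then the square norms of
the coordinates are controlled by the off-diagonal entries. -/
theorem sum_norm_sq_le_sum_offDiag {ι : Type*} [Fintype ι] [DecidableEq ι] {A : Matrix ι ι K}
    (hA : ∀ i, A i i = 1) {k : ℕ} {f : Fin k → ι → K} (hf : ∀ a, mulVecRight A (f a) = 0) :
    ∑ i, ∑ a, ‖f a i‖ ^ 2 ≤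
      ∑ ij ∈ (Finset.univ : Finset ι).offDiag,
        ‖A ij.1 ij.2‖ * ‖∑ a, f a ij.2 * star (f a ij.1)‖ := by
  have hker : ∀ i, ∑ j, A i j * ∑ a, f a j * star (f a i) = 0 := by
    intro i
    simp only [Finset.mul_sum, ← mul_assoc]
    rw [Finset.sum_comm]
    refine Finset.sum_eq_zero fun a _ => ?_
    rw [← Finset.sum_mul]
    have h : ∑ j, A i j * f a j = 0 := congrFun (hf a) i
    rw [h, zero_mul]
  have hrow : ∀ i, ∑ a, ‖f a i‖ ^ 2 ≤
      ∑ j ∈ Finset.univ.erase i, ‖A i j‖ * ‖∑ a, f a j * star (f a i)‖ := by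
    intro i
    have h := hker i
    rw [← Finset.add_sum_erase _ _ (Finset.mem_univ i), hA, one_mul] at h
    rw [← norm_sum_mul_star_self, eq_neg_of_add_eq_zero_left h, norm_neg]
    refine (norm_sum_le _ _).trans (le_of_eq ?_)
    simp only [norm_mul]
  refine (Finset.sum_le_sum fun i _ => hrow i).trans (le_of_eq ?_)
  rw [Finset.sum_sigma' Finset.univ fun i => Finset.univ.erase i]
  refine Finset.sum_bij' (fun x _ => (x.1, x.2)) (fun x _ => ⟨x.1, x.2⟩) ?_ ?_ ?_ ?_ ?_ <;>
    simp +contextual [eq_comm]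

theorem sum_rpow_le_of_le_one {N : ℕ} (hN : 0 < N) {r : ℝ} (hr0 : 0 < r) (hr1 : r ≤ 1)
    (l : Fin N → ℝ) (hl : ∀ i, 0 ≤ l i) : ∑ i, l i ^ r ≤ N * ((∑ i, l i) / N) ^ r := by
  have hN' : (0 : ℝ) < N := by exact_mod_cast hN
  have h := (Real.concaveOn_rpow hr0.le hr1).le_map_sum (t := Finset.univ) (w := fun _ => 1 / (N : ℝ))
    (p := l) (fun _ _ => by positivity) (by simp; field_simp) (fun i _ => hl i)
  simp only [smul_eq_mul, ← Finset.mul_sum] at h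
  rw [one_div_mul_eq_div, one_div_mul_eq_div, div_le_iff₀ hN'] at h
  linarith

theorem le_sum_rpow_of_one_le {N : ℕ} (hN : 0 < N) {r : ℝ} (hr1 : 1 ≤ r)
    (l : Fin N → ℝ) (hl : ∀ i, 0 ≤ l i) : N * ((∑ i, l i) / N) ^ r ≤ ∑ i, l i ^ r := by
  have hN' : (0 : ℝ) < N := by exact_mod_cast hN
  have h := (convexOn_rpow hr1).map_sum_le (t := Finset.univ) (w := fun _ => 1 / (N : ℝ))
    (p := l) (fun _ _ => by positivity) (by simp; field_simp) (fun i _ => hl i)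
  simp only [smul_eq_mul, ← Finset.mul_sum] at h
  rw [one_div_mul_eq_div, one_div_mul_eq_div, le_div_iff₀ hN'] at h
  linarith

theorem le_offDiagNorm_of_simplex_bound [FiniteDimensional ℝ K] {N k : ℕ} {p q M b : ℝ}
    (hpq : p.HolderConjugate q) (hq2 : q ≤ 2) (hk : 0 < k)
    (hM : k + ((k : ℝ) ^ 2 - k) / 2 * Module.finrank ℝ K ≤ M) (hM1 : 1 ≤ M)
    (hb0 : 0 < b) (hb1 : b < 1) (hkb : 1 / (k : ℝ) = b + (1 - b) / M)
    {A : Matrix (Fin N) (Fin N) K} (hA : ∀ i, A i i = 1)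
    (hker : Module.finrank Kᵐᵒᵖ (LinearMap.ker (mulVecRight A)) = k) :
    N / ((N : ℝ) ^ 2 * (b ^ (q / 2) + 1 / M * (1 - b ^ (q / 2))) - N) ^ (1 / q) ≤
      offDiagNorm p A := by
  have hk' : (0 : ℝ) < k := by exact_mod_cast hk
  have hq1 : 1 ≤ q := hpq.symm.lt.le
  have hq0 : 0 < q := by linarith
  obtain ⟨c, f, hc, hf, hfU, hl⟩ := exists_lewis_weights _ hker hq0 hq2
  have hN : 0 < N := by
    rcases N.eq_zero_or_pos with rfl | h
    · have := hf.sum_mul_leverage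
      rw [Fintype.sum_empty] at this
      linarith
    · exact h
  have hN' : (0 : ℝ) < N := by exact_mod_cast hN
  have henergy := sum_norm_rpow_le_simplex hc hf hq0 hq2 hl hk hM hM1 hb0 hb1 hkb
  set S : ℝ := b ^ (q / 2) + 1 / M * (1 - b ^ (q / 2)) with hS
  have hS0 : 0 ≤ S := by
    have h1 : 0 ≤ b ^ (q / 2) := Real.rpow_nonneg hb0.le _
    have h2 : b ^ (q / 2) ≤ 1 := Real.rpow_le_one hb0.le hb1.le (by linarith)
    have h3 : 0 ≤ 1 / M := by positivity
    exact add_nonneg h1 (mul_nonneg h3 (by linarith))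
  set B : Fin N → Fin N → ℝ := fun i j => ‖∑ a, f a i * star (f a j)‖ with hB
  set l : Fin N → ℝ := fun i => ∑ a, ‖f a i‖ ^ 2 with hldef
  have hl0 : ∀ i, 0 ≤ l i := fun i => Finset.sum_nonneg fun _ _ => sq_nonneg _
  set t : ℝ := (∑ i, l i) / N with ht
  have hself : ∀ i, B i i = l i := fun i => norm_sum_mul_star_self _
  have hsumk : ∑ i, l i ^ (q / 2) = k := by
    rw [← hf.sum_mul_leverage]
    exact Finset.sum_congr rfl fun i _ => (hl i).symm
  have hkt : (k : ℝ) ≤ N * t ^ (q / 2) := by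
    rw [← hsumk]
    exact sum_rpow_le_of_le_one hN (by linarith) (by linarith) l hl0
  have ht0 : 0 ≤ t := div_nonneg (Finset.sum_nonneg fun i _ => hl0 i) hN'.le
  have htpos : 0 < t := by
    rcases ht0.eq_or_lt with h | h
    · rw [← h, Real.zero_rpow (by linarith), mul_zero] at hkt
      linarith
    · exact h
  have htq : (t ^ (q / 2)) ^ 2 = t ^ q := by
    rw [← Real.rpow_mul_natCast ht0]
    congr 1
    push_cast
    ring
  -- Jensen is used twice: `k ≤ N * t ^ (q / 2)` bounds the total energy from above, and the
  -- convexity of `x ^ q` bounds the diagonal energy from below by `N * t ^ q`.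
  have hoff : ∑ ij ∈ (Finset.univ : Finset (Fin N)).offDiag, B ij.2 ij.1 ^ q ≤
      t ^ q * ((N : ℝ) ^ 2 * S - N) := by
    have h1 : ∑ i, ∑ j, B j i ^ q = ∑ i, l i ^ q +
        ∑ ij ∈ (Finset.univ : Finset (Fin N)).offDiag, B ij.2 ij.1 ^ q := by
      rw [← Finset.sum_product', ← Finset.diag_union_offDiag,
        Finset.sum_union (Finset.disjoint_diag_offDiag _), Finset.sum_diag]
      simp only [hself]
    have h2 : ∑ i, ∑ j, B j i ^ q ≤ (k : ℝ) ^ 2 * S := by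
      rw [Finset.sum_comm]
      exact henergy
    have h3 := le_sum_rpow_of_one_le hN hq1 l hl0
    have h4 : (k : ℝ) ^ 2 * S ≤ (N : ℝ) ^ 2 * t ^ q * S := by
      rw [← htq, ← mul_pow]
      exact mul_le_mul_of_nonneg_right (pow_le_pow_left₀ hk'.le hkt 2) hS0
    change N * t ^ q ≤ _ at h3
    linarith
  have hX : 0 ≤ (N : ℝ) ^ 2 * S - N := by
    refine nonneg_of_mul_nonneg_right (le_trans ?_ hoff) (Real.rpow_pos_of_pos htpos q)
    exact Finset.sum_nonneg fun ij _ => Real.rpow_nonneg (norm_nonneg _) _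
  have hmain := (sum_norm_sq_le_sum_offDiag hA fun a => LinearMap.mem_ker.1 (hfU a)).trans
    (Real.inner_le_Lp_mul_Lq _ (fun ij : Fin N × Fin N => ‖A ij.1 ij.2‖)
      (fun ij => B ij.2 ij.1) hpq)
  simp only [abs_norm] at hmain
  have hBabs : ∀ i j, |B i j| = B i j := fun i j => abs_of_nonneg (norm_nonneg _)
  simp only [hBabs] at hmain
  have hnorm0 : 0 ≤ offDiagNorm p A := Real.rpow_nonneg
    (Finset.sum_nonneg fun ij _ => Real.rpow_nonneg (norm_nonneg _) _) _
  have hroot : (∑ ij ∈ (Finset.univ : Finset (Fin N)).offDiag, B ij.2 ij.1 ^ q) ^ (1 / q) ≤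
      t * ((N : ℝ) ^ 2 * S - N) ^ (1 / q) := by
    refine (Real.rpow_le_rpow (Finset.sum_nonneg fun ij _ => Real.rpow_nonneg (norm_nonneg _) _)
      hoff (by positivity)).trans (le_of_eq ?_)
    rw [Real.mul_rpow (by positivity) hX, ← Real.rpow_mul ht0, mul_one_div_cancel hq0.ne',
      Real.rpow_one]
  -- Both sides are linear in the mean leverage `t > 0`, so it cancels.
  have hfin : N * t ≤ offDiagNorm p A * (t * ((N : ℝ) ^ 2 * S - N) ^ (1 / q)) := by
    rw [ht, mul_div_cancel₀ _ hN'.ne']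
    exact hmain.trans (mul_le_mul_of_nonneg_left hroot hnorm0)
  refine div_le_of_le_mul₀ (Real.rpow_nonneg hX _) hnorm0 ?_
  refine le_of_mul_le_mul_right ?_ htpos
  linarith

theorem energyLowerBound_le_offDiagNorm [FiniteDimensional ℝ K] {N d : ℕ} (hd : d < N) {p : ℝ}
    (hp : 2 ≤ p) {A : Matrix (Fin N) (Fin N) K} (hA : ∀ i, A i i = 1) (hr : colRank A = d) :
    energyLowerBound K N (N - d) p ≤ offDiagNorm p A := by
  have hk : 0 < N - d := by omega
  set k := N - d with hkdef
  have hk1 : (1 : ℝ) ≤ k := by exact_mod_cast hk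
  have hD : (1 : ℝ) ≤ Module.finrank ℝ K := by
    exact_mod_cast (Module.finrank_pos (R := ℝ) (M := K))
  set D : ℝ := (Module.finrank ℝ K : ℝ) with hDdef
  have hpq : p.HolderConjugate (p / (p - 1)) := Real.HolderConjugate.conjExponent (by linarith)
  set q := p / (p - 1) with hq
  have hq2 : q ≤ 2 := by
    rw [hq, div_le_iff₀ (by linarith)]
    linarith
  have hkk : 0 ≤ ((k : ℝ) ^ 2 - k) / 2 := by nlinarith
  have hM1 : 1 ≤ simplexSize K k := by
    unfold simplexSize
    nlinarith
  -- `b` is the square of `simplexCos K k`, which explains the exponent `q / 2` in place of `q`.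
  set b : ℝ := 1 / ((k : ℝ) + 2 * D⁻¹) with hb
  have hb0 : 0 < b := by positivity
  have hb1 : b < 1 := by
    rw [hb, div_lt_one (by positivity)]
    have : 0 < D⁻¹ := by positivity
    linarith
  -- The mean inner product of the simplex is `1 / k`, because `1 - b = b * X` and `M = k * D / 2 *
  -- X` share the factor `X = 2 * D⁻¹ + k - 1`.
  have hkb : 1 / (k : ℝ) = b + (1 - b) / simplexSize K k := by
    have hM : simplexSize K k = k + ((k : ℝ) ^ 2 - k) / 2 * D := rfl
    have hM' : k + ((k : ℝ) ^ 2 - k) / 2 * D = k * D / 2 * (2 * D⁻¹ + k - 1) := by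
      field_simp
      ring
    have h0 : 2 * D⁻¹ + k - 1 ≠ 0 := by
      have : 0 < D⁻¹ := by positivity
      linarith
    have h1 : (1 - b) / simplexSize K k = b * (2 / (k * D)) := by
      have h2 : 1 - b = b * (2 * D⁻¹ + k - 1) := by
        rw [hb]
        field_simp
        ring
      rw [hM, hM', h2]
      generalize 2 * D⁻¹ + (k : ℝ) - 1 = X at h0
      field_simp
    rw [h1, hb]
    field_simp
  have hcos : simplexCos K k ^ q = b ^ (q / 2) := by
    have h : simplexCos K k = Real.sqrt b := rfl
    rw [h, Real.sqrt_eq_rpow, ← Real.rpow_mul hb0.le]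
    congr 1
    ring
  have hexp : 1 - 1 / p = 1 / q := by
    rw [hq]
    have : p - 1 ≠ 0 := by linarith
    field_simp
  have h := le_offDiagNorm_of_simplex_bound (p := p) hpq hq2 hk (le_refl _) hM1 hb0 hb1 hkb hA
    (by rw [finrank_ker_mulVecRight, hr, Fintype.card_fin])
  unfold energyLowerBound
  rw [← hq, hcos, hexp]
  exact h

end FinalEstimate

theorem mainTheorem3 (N d : ℕ) (hd : d < N) (p : ℝ) (hp : 2 ≤ p) :
    (∀ A : Matrix (Fin N) (Fin N) ℝ, (∀ i, A i i = 1) → colRank A = d →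
      energyLowerBound ℝ N (N - d) p ≤ offDiagNorm p A) ∧
    (∀ A : Matrix (Fin N) (Fin N) ℂ, (∀ i, A i i = 1) → colRank A = d →
      energyLowerBound ℂ N (N - d) p ≤ offDiagNorm p A) ∧
    (∀ A : Matrix (Fin N) (Fin N) ℍ[ℝ], (∀ i, A i i = 1) → colRank A = d →
      energyLowerBound ℍ[ℝ] N (N - d) p ≤ offDiagNorm p A) := by
  exact ⟨fun _ hA hr => energyLowerBound_le_offDiagNorm hd hp hA hr,
    fun _ hA hr => energyLowerBound_le_offDiagNorm hd hp hA hr,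
    fun _ hA hr => energyLowerBound_le_offDiagNorm hd hp hA hr⟩
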